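/- Let $d=m+n$ and let $A=(a_{ki})$ be an integer $m\times d$ matrix with linearly independent rows. Let $M\subset T^d$ be the $m$-dimensional subtorus whose Lie algebra $\mathfrak m\subset\mathfrak t^d=\mathbb R^d$ is spanned by the rows of $A$, and let $N=T^d/M$. The torus $T^d$ acts on $\mathbb H^d=\mathbb C^d\times\mathbb C^d$ by $(z,w)\zeta=(z\zeta,w\zeta^{-1})$. In the basis of $\mathfrak m^*$ dual to the rows of $A$, the hyperkähler moment map of $M$ has components $$\mu_{\mathbb R}(z,w)_k=\tfrac12\sum_{i=1}^d(|z_i|^2-|w_i|^2)\,a_{ki},\qquad \mu_{\mathbb C}(z,w)_k=\sum_{i=1}^d z_iw_i\,a_{ki}.$$ For $\alpha\in\mathbb R^m$, $\beta\in\mathbb C^m$ let $Y(\alpha,\beta)=\bigl(\mu_{\mathbb R}^{-1}(\alpha)\cap\mu_{\mathbb C}^{-1}(\beta)\bigr)/M$, on which $N$ acts. Put $\mathfrak N_\alpha=\{x\in\mathbb R^d: Ax=\alpha\}\cong\mathfrak n^*$ and $\mathfrak N_\beta=\{y\in\mathbb C^d: Ay=\beta\}\cong\mathfrak n^*_{\mathbb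 C}$, and define the residual moment maps $$\bar\mu_{\mathbb R}:Y(\alpha,\beta)\to\mathfrak N_\alpha,\quad [z,w]\mapsto\bigl(\tfrac12(|z_i|^2-|w_i|^2)\bigr)_i,\qquad \bar\mu_{\mathbb C}:Y(\alpha,\beta)\to\mathfrak N_\beta,\quad [z,w]\mapsto(z_iw_i)_i ,$$ and the walls $W_i=\mathfrak N_\beta\cap\{y_i=0\}$, $i=1,\dots,d$. A real function on $Y(\alpha,\beta)$ is called smooth if its pullback to the level set is locally the restriction of a smooth function on an open subset of $\mathbb H^d$. A real function on a fiber $F_b=\bar\mu_{\mathbb C}^{-1}(b)$ is called smooth if it is locally the restriction of a smooth function on $Y(\alpha,\beta)$. **Theorem.** Let $b\in\mathfrak N_\beta\setminus\bigcup_{i=1}^d W_i$. Then: 1. $F_b$, with the subspace topology, is Hausdorff and second countable, and it carries the structure of a smooth manifold of real dimension $2n$ whose smooth real functions are exactly those just described. 2. $N$ acts smoothly and freely on $F_b$. 3. $\bar\mu_{\mathbb R}$ restricts to a smooth surjective submersion of $F_b$ onto the $n$-dimensional real affine space $\mathfrak N_\alpha\cong\mathbb R^n$. 4. $F_b$ is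 diffeomorphic to the complex torus $(\mathbb C^*)^n$ and to $T^n\times\mathbb R^n$. -/

import Mathlib

open scoped Manifold ContDiff Topology Matrix

noncomputable section

namespace ToricHK

/-- The flat quaternionic space `ℍ^d = T^*ℂ^d = ℂ^d × ℂ^d`, with points `(z, w)`. -/
abbrev HSpace (d : ℕ) : Type := (Fin d → ℂ) × (Fin d → ℂ)

/-- The real torus `T^d`. -/
abbrev Torus (d : ℕ) : Type := Fin d → Circle

variable {m d : ℕ}

/-- The action of the torus on `ℍ^d`: `(z, w) ζ = (z ζ, w ζ⁻¹)`. -/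
def act (ζ : Torus d) (p : HSpace d) : HSpace d :=
  (fun i => p.1 i * (ζ i : ℂ), fun i => p.2 i * ((ζ i)⁻¹ : Circle))

/-- The subtorus `M` of `T^d` whose Lie algebra is spanned by the rows of the integer matrix `A`,
i.e. the image under the exponential map of the real span of the rows. -/
def subtorus (A : Matrix (Fin m) (Fin d) ℤ) : Subgroup (Torus d) where
  carrier := {ζ | ∃ t : Fin m → ℝ, ∀ i, ζ i = Circle.exp (∑ k, t k * (A k i : ℝ))}
  mul_mem' := by
    rintro ζ ξ ⟨t, ht⟩ ⟨s, hs⟩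
    refine ⟨t + s, fun i => ?_⟩
    simp [ht, hs, add_mul, Finset.sum_add_distrib, Circle.exp_add]
  one_mem' := ⟨0, fun i => by simp⟩
  inv_mem' := by
    rintro ζ ⟨t, ht⟩
    refine ⟨-t, fun i => ?_⟩
    simp [ht, Circle.exp_neg]

/-- The vector with coordinates `(|z_i|² - |w_i|²) / 2`. -/
def realCoord (p : HSpace d) : Fin d → ℝ := fun i => (‖p.1 i‖ ^ 2 - ‖p.2 i‖ ^ 2) / 2

/-- The vector with coordinates `z_i w_i`. -/
def complexCoord (p : HSpace d) : Fin d → ℂ := fun i => p.1 i * p.2 i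

/-- The real solution space `{x ∈ ℝ^d | A x = α}`, identified with the dual Lie algebra of the
quotient torus. -/
def realSolutions (A : Matrix (Fin m) (Fin d) ℤ) (α : Fin m → ℝ) : Set (Fin d → ℝ) :=
  {x | A.map (Int.cast : ℤ → ℝ) *ᵥ x = α}

/-- The complex solution space `{y ∈ ℂ^d | A y = β}`, identified with the complexified dual Lie
algebra of the quotient torus. -/
def complexSolutions (A : Matrix (Fin m) (Fin d) ℤ) (β : Fin m → ℂ) : Set (Fin d → ℂ) :=
  {y | A.map (Int.cast : ℤ → ℂ) *ᵥ y = β}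

/-- The wall `W_i`: the part of the complex solution space in the `i`-th coordinate hyperplane. -/
def wall (A : Matrix (Fin m) (Fin d) ℤ) (β : Fin m → ℂ) (i : Fin d) : Set (Fin d → ℂ) :=
  complexSolutions A β ∩ {y | y i = 0}

/-- The real moment map of the subtorus, `½ ∑ i, (|z_i|² - |w_i|²) ι^* e_i^*`, written in the basis
dual to the rows of `A`, in which `ι^* e_i^*` is the `i`-th column of `A`. -/
def realMu (A : Matrix (Fin m) (Fin d) ℤ) (p : HSpace d) : Fin m → ℝ :=
  fun k => (1 / 2) * ∑ i, (‖p.1 i‖ ^ 2 - ‖p.2 i‖ ^ 2) * (A k i : ℝ)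

/-- The complex moment map of the subtorus, `∑ i, z_i w_i ι^* e_i^*`, in the same basis. -/
def complexMu (A : Matrix (Fin m) (Fin d) ℤ) (p : HSpace d) : Fin m → ℂ :=
  fun k => ∑ i, p.1 i * p.2 i * (A k i : ℂ)

/-- The level set of the hyperkähler moment map of the subtorus. -/
def levelSet (A : Matrix (Fin m) (Fin d) ℤ) (α : Fin m → ℝ) (β : Fin m → ℂ) : Set (HSpace d) :=
  {p | realMu A p = α ∧ complexMu A p = β}

theorem act_one (p : HSpace d) : act 1 p = p := by
  ext i <;> simp [act]

theorem act_mul (ζ ξ : Torus d) (p : HSpace d) : act (ζ * ξ) p = act ζ (act ξ p) := by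
  ext i <;> simp only [act, Pi.mul_apply, mul_inv_rev, Circle.coe_mul] <;> ring

theorem realCoord_act (ζ : Torus d) (p : HSpace d) : realCoord (act ζ p) = realCoord p := by
  ext i; simp only [act, realCoord, norm_mul, Circle.norm_coe, mul_one]

theorem complexCoord_act (ζ : Torus d) (p : HSpace d) :
    complexCoord (act ζ p) = complexCoord p := by
  ext i
  have h : (ζ i : ℂ) ≠ 0 := Circle.coe_ne_zero _
  simp only [act, complexCoord, Circle.coe_inv]
  field_simp

theorem act_mem_levelSet (A : Matrix (Fin m) (Fin d) ℤ) {α : Fin m → ℝ} {β : Fin m → ℂ}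
    (ζ : Torus d) {p : HSpace d} (hp : p ∈ levelSet A α β) : act ζ p ∈ levelSet A α β := by
  refine ⟨?_, ?_⟩
  · rw [← hp.1]; ext k; simp only [realMu, act, norm_mul, Circle.norm_coe, mul_one]
  · rw [← hp.2]; ext k
    refine Finset.sum_congr rfl fun i _ => ?_
    exact congrArg (· * (A k i : ℂ)) (congrFun (complexCoord_act ζ p) i)

/-- Two points of the level set are equivalent when they lie in the same orbit of the subtorus. -/
def orbitSetoid (A : Matrix (Fin m) (Fin d) ℤ) (α : Fin m → ℝ) (β : Fin m → ℂ) :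
    Setoid (levelSet A α β) where
  r p q := ∃ ζ ∈ subtorus A, act ζ p.1 = q.1
  iseqv :=
    { refl := fun p => ⟨1, one_mem _, act_one _⟩
      symm := by
        rintro p q ⟨ζ, hζ, h⟩
        exact ⟨ζ⁻¹, inv_mem hζ, by rw [← h, ← act_mul, inv_mul_cancel, act_one]⟩
      trans := by
        rintro p q r ⟨ζ, hζ, h⟩ ⟨ξ, hξ, h'⟩
        exact ⟨ξ * ζ, mul_mem hξ hζ, by rw [act_mul, h, h']⟩ }

/-- The toric hyperkähler variety `Y(α, β)`: the hyperkähler quotient of the level set by the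
subtorus, with the quotient topology. -/
def Y (A : Matrix (Fin m) (Fin d) ℤ) (α : Fin m → ℝ) (β : Fin m → ℂ) : Type :=
  Quotient (orbitSetoid A α β)

variable {A : Matrix (Fin m) (Fin d) ℤ} {α : Fin m → ℝ} {β : Fin m → ℂ}

instance : TopologicalSpace (Y A α β) :=
  inferInstanceAs (TopologicalSpace (Quotient (orbitSetoid A α β)))

/-- The projection of the level set onto `Y(α, β)`. -/
def proj (p : levelSet A α β) : Y A α β := Quotient.mk (orbitSetoid A α β) p

/-- The action of the quotient torus `N = T^d / M` on `Y(α, β)`. -/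
instance : MulAction (Torus d ⧸ subtorus A) (Y A α β) where
  smul g y := Quotient.liftOn₂ g y
    (fun ζ p => proj ⟨act ζ p.1, act_mem_levelSet A ζ p.2⟩) (by
      rintro ζ p ξ q h ⟨η, hη, h'⟩
      refine Quotient.sound ⟨η * (ζ⁻¹ * ξ),
        mul_mem hη (QuotientGroup.leftRel_apply.mp h), ?_⟩
      change act (η * (ζ⁻¹ * ξ)) (act ζ p.1) = act ξ q.1
      rw [← h', ← act_mul, ← act_mul]
      congr 1
      rw [mul_assoc, inv_mul_cancel_comm, mul_comm])
  one_smul y := by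
    induction y using Quotient.inductionOn with
    | h p => exact congrArg proj (Subtype.ext (act_one p.1))
  mul_smul g h y := by
    induction g using Quotient.inductionOn with
    | h ζ =>
      induction h using Quotient.inductionOn with
      | h ξ =>
        induction y using Quotient.inductionOn with
        | h p => exact congrArg proj (Subtype.ext (act_mul ζ ξ p.1))

theorem mk_smul_proj (ζ : Torus d) (p : levelSet A α β) :
    (ζ : Torus d ⧸ subtorus A) • proj p = proj ⟨act ζ p.1, act_mem_levelSet A ζ p.2⟩ := rfl

/-- The residual real moment map `[z, w] ↦ ½ ∑ i, (|z_i|² - |w_i|²) e_i^*`. -/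
def realMoment (y : Y A α β) : Fin d → ℝ :=
  Quotient.liftOn y (fun p => realCoord p.1) (by
    rintro p q ⟨ζ, _, h⟩
    rw [← h, realCoord_act])

/-- The residual complex moment map `[z, w] ↦ ∑ i, z_i w_i e_i^*`. -/
def complexMoment (y : Y A α β) : Fin d → ℂ :=
  Quotient.liftOn y (fun p => complexCoord p.1) (by
    rintro p q ⟨ζ, _, h⟩
    rw [← h, complexCoord_act])

theorem realMoment_mem (y : Y A α β) : realMoment y ∈ realSolutions A α := by
  induction y using Quotient.inductionOn with
  | h p =>
    change A.map (Int.cast : ℤ → ℝ) *ᵥ realCoord p.1 = α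
    refine Eq.trans ?_ p.2.1
    ext k
    simp only [Matrix.mulVec, dotProduct, realCoord, realMu, Matrix.map_apply, Finset.mul_sum]
    exact Finset.sum_congr rfl fun i _ => by ring

theorem complexMoment_mem (y : Y A α β) : complexMoment y ∈ complexSolutions A β := by
  induction y using Quotient.inductionOn with
  | h p =>
    change A.map (Int.cast : ℤ → ℂ) *ᵥ complexCoord p.1 = β
    refine Eq.trans ?_ p.2.2
    ext k
    simp only [Matrix.mulVec, dotProduct, complexCoord, complexMu, Matrix.map_apply]
    exact Finset.sum_congr rfl fun i _ => by ring

theorem complexMoment_smul (g : Torus d ⧸ subtorus A) (y : Y A α β) :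
    complexMoment (g • y) = complexMoment y := by
  induction g using Quotient.inductionOn with
  | h ζ =>
    induction y using Quotient.inductionOn with
    | h p => exact complexCoord_act ζ p.1

/-- The fiber `F_b` of the residual complex moment map, with the subspace topology of `Y(α, β)`. -/
abbrev Fiber (A : Matrix (Fin m) (Fin d) ℤ) (α : Fin m → ℝ) (β : Fin m → ℂ) (b : Fin d → ℂ) :
    Type :=
  {y : Y A α β // complexMoment y = b}

/-- The action of the quotient torus `N = T^d / M` restricted to a fiber. -/
instance (b : Fin d → ℂ) : MulAction (Torus d ⧸ subtorus A) (Fiber A α β b) where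
  smul g y := ⟨g • y.1, (complexMoment_smul g y.1).trans y.2⟩
  one_smul y := Subtype.ext (one_smul _ y.1)
  mul_smul g h y := Subtype.ext (mul_smul g h y.1)

/-- Smooth functions on the quotient `Y(α, β)`: those whose pullback to the level set is, near
every point, the restriction of a smooth function on an open subset of `ℍ^d`. -/
def IsSmoothFun (f : Y A α β → ℝ) : Prop :=
  ∀ p : levelSet A α β, ∃ (U : Set (HSpace d)) (g : HSpace d → ℝ), IsOpen U ∧ p.1 ∈ U ∧
    ContDiffOn ℝ ∞ g U ∧ ∀ q : levelSet A α β, q.1 ∈ U → f (proj q) = g q.1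

/-- Smooth functions on a fiber, as a subspace of `Y(α, β)`: those which are, near every point,
the restriction of a smooth function on `Y(α, β)`. -/
def IsSmoothFunOnFiber {b : Fin d → ℂ} (f : Fiber A α β b → ℝ) : Prop :=
  ∀ y : Fiber A α β b, ∃ g : Y A α β → ℝ, IsSmoothFun g ∧ ∀ᶠ x in 𝓝 y, f x = g x.1

/-- The model with corners (without boundary) of the torus `T^d` as a real smooth manifold. -/
abbrev torusModel (d : ℕ) := ModelWithCorners.pi (fun _ : Fin d => 𝓡 1)

/-- The model with corners (without boundary) of `(ℂ^*)^n` as a real smooth manifold. -/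
abbrev complexTorusModel (n : ℕ) := ModelWithCorners.pi (fun _ : Fin n => 𝓘(ℝ, ℂ))

end ToricHK

end

/-! Off the walls every `b i` is nonzero, so on the fiber all `z i` are nonzero and `w i = b i / z
i`. The modulus `r = |z i|` is then the unique positive solution of `(r² - |b i|² / r²) / 2 = x i`,
a smooth function of the real coordinate `x i` (`eq_radius`, `contDiff_radius`). Hence the part of
the level set over `b` is `T^d` times the real solution space, by phases and real coordinates, and
`M` acts on it by translating the phases. So `F_b` is `(T^d / M)` times an affine space of dimension
`n`.

The factor `T^d / M` is made explicit by lattices. The kernel of `A` on `ℤ^d` is a direct summand;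
with a basis as the rows of `B` and a right inverse `C`, the monomial map of `B` has kernel exactly
`M`, and that of `C` is a section (`exists_isSplitting`, `IsSplitting.monomial_eq_one_iff`). This
gives `fiberHomeo` onto `T^n × ℝ^n`, along which the manifold structure is pulled back. In these
coordinates `N` acts by translations of `T^n`, the real moment map is an affine parametrization of
the second factor, and polar coordinates give `(ℂ^*)^n`.

It remains to see that this structure has the prescribed smooth functions. One direction restricts
local extensions along the smooth lift `flatPoint`. The other must extend a function of the
coordinates to all of `Y(α, β)`, including points where some `z i` vanishes and phases are
undefined; a torus-invariant cutoff does this (`isSmoothFun_cutoff_mul`). -/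

noncomputable section

namespace ToricHK

/-! ### Finite products of manifolds -/

section PiManifold

variable {𝕜 : Type*} [NontriviallyNormedField 𝕜] {ι : Type*} [Fintype ι]
  {E : ι → Type*} [∀ i, NormedAddCommGroup (E i)] [∀ i, NormedSpace 𝕜 (E i)]
  {H : ι → Type*} [∀ i, TopologicalSpace (H i)] (I : ∀ i, ModelWithCorners 𝕜 (E i) (H i))
  {M : ι → Type*} [∀ i, TopologicalSpace (M i)] [∀ i, ChartedSpace (H i) (M i)]

theorem range_modelPi : Set.range (ModelWithCorners.pi I) = Set.univ.pi fun i => Set.range (I i) :=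
  Set.range_piMap _

instance boundaryless_pi [∀ i, (I i).Boundaryless] : (ModelWithCorners.pi I).Boundaryless :=
  ⟨by simp [range_modelPi, ModelWithCorners.range_eq_univ]⟩

/-- A finite product of `C^n` manifolds is a `C^n` manifold. -/
instance isManifold_pi (n : ℕ∞ω) [∀ i, IsManifold (I i) n (M i)] :
    IsManifold (ModelWithCorners.pi I) n (∀ i, M i) := by
  refine isManifold_of_contDiffOn _ _ _ ?_
  rintro _ _ ⟨e, he, rfl⟩ ⟨e', he', rfl⟩
  rw [contDiffOn_pi]
  intro i
  have h := (contDiffGroupoid n (I i)).compatible (he i trivial) (he' i trivial)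
  rw [contDiffGroupoid, mem_groupoid_of_pregroupoid] at h
  have h1 : ContDiffOn 𝕜 n (I i ∘ (e i).symm ≫ₕ e' i ∘ (I i).symm)
    ((I i).symm ⁻¹' ((e i).symm ≫ₕ e' i).source ∩ Set.range (I i)) := h.1
  refine h1.comp (t := (I i).symm ⁻¹' ((e i).symm ≫ₕ e' i).source ∩ Set.range (I i))
    (f := fun x : ∀ i, E i => x i) (ContinuousLinearMap.proj (R := 𝕜) (φ := E) i).contDiff.contDiffOn ?_
  rintro x ⟨hx, hx'⟩
  rw [range_modelPi] at hx'
  exact ⟨⟨hx.1 i trivial, hx.2 i trivial⟩, hx' i trivial⟩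

variable {I}
variable {E' : Type*} [NormedAddCommGroup E'] [NormedSpace 𝕜 E'] {H' : Type*} [TopologicalSpace H']
  {J : ModelWithCorners 𝕜 E' H'} {N : Type*} [TopologicalSpace N] [ChartedSpace H' N]

/-- The extended chart of a product is the product of the extended charts, so after passing to the
target chart this is the statement for maps into a product of vector spaces. -/
theorem contMDiffAt_pi_iff {n : ℕ∞ω} {f : N → ∀ i, M i} {x : N} :
    ContMDiffAt J (ModelWithCorners.pi I) n f x ↔
      ∀ i, ContMDiffAt J (I i) n (fun y => f y i) x := by
  have h (i : ι) := contMDiffAt_iff_target (I := J) (I' := I i) (n := n) (f := fun y => f y i)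
    (x := x)
  rw [contMDiffAt_iff_target, forall_congr' h, forall_and, continuousAt_pi]
  exact and_congr_right fun _ => contMDiffAt_pi_space

theorem contMDiff_pi_iff {n : ℕ∞ω} {f : N → ∀ i, M i} :
    ContMDiff J (ModelWithCorners.pi I) n f ↔ ∀ i, ContMDiff J (I i) n (fun y => f y i) :=
  ⟨fun h i x => contMDiffAt_pi_iff.1 (h x) i, fun h x => contMDiffAt_pi_iff.2 fun i => h i x⟩

theorem contMDiff_eval {n : ℕ∞ω} (i : ι) :
    ContMDiff (ModelWithCorners.pi I) (I i) n (fun x : ∀ i, M i => x i) :=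
  contMDiff_pi_iff.1 contMDiff_id i

end PiManifold

/-! ### Pulling back a manifold structure along a homeomorphism -/

section Transport

variable {E : Type*} [NormedAddCommGroup E] [NormedSpace ℝ E] {H : Type*} [TopologicalSpace H]
  (I : ModelWithCorners ℝ E H) [I.Boundaryless] {X : Type*} [TopologicalSpace X] [ChartedSpace H X]
  {V : Type*} [NormedAddCommGroup V] [NormedSpace ℝ V] (L : E ≃L[ℝ] V)
  {F : Type*} [TopologicalSpace F] (Φ : F ≃ₜ X)

/-- The homeomorphism of the model space of a boundaryless model with a linear model space. -/
def modelHomeo : H ≃ₜ V := I.toHomeomorph.trans L.toHomeomorph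

/-- The charted space structure pulled back along a homeomorphism, with the model space
replaced by a vector space. -/
@[reducible]
def transportCharts : ChartedSpace V F where
  atlas := (fun e : OpenPartialHomeomorph X H =>
    Φ.toOpenPartialHomeomorph ≫ₕ (e ≫ₕ (modelHomeo I L).toOpenPartialHomeomorph)) '' atlas H X
  chartAt y := Φ.toOpenPartialHomeomorph ≫ₕ
    (chartAt H (Φ y) ≫ₕ (modelHomeo I L).toOpenPartialHomeomorph)
  mem_chart_source y := by simp
  chart_mem_atlas y := ⟨_, chart_mem_atlas H (Φ y), rfl⟩

/-- The new transition maps are the old ones conjugated by the linear map `L`. -/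
theorem isManifold_transport (n : ℕ∞ω) [IsManifold I n X] :
    letI := transportCharts I L Φ
    IsManifold 𝓘(ℝ, V) n F := by
  let := transportCharts I L Φ
  refine isManifold_of_contDiffOn _ _ _ ?_
  rintro _ _ ⟨e, he, rfl⟩ ⟨e', he', rfl⟩
  have h := (contDiffGroupoid n I).compatible he he'
  rw [contDiffGroupoid, mem_groupoid_of_pregroupoid] at h
  have h1 : ContDiffOn ℝ n (I ∘ e.symm ≫ₕ e' ∘ I.symm)
    (I.symm ⁻¹' (e.symm ≫ₕ e').source ∩ Set.range I) := h.1
  refine ((L.contDiff.comp_contDiffOn h1).comp (f := L.symm) L.symm.contDiff.contDiffOn ?_).congr ?_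
  · rintro x ⟨hx, hx'⟩
    refine ⟨?_, by simp [I.range_eq_univ]⟩
    simpa [modelHomeo, ModelWithCorners.toHomeomorph] using hx
  · rintro x ⟨hx, hx'⟩
    simp [modelHomeo, ModelWithCorners.toHomeomorph]

/-- In the pulled-back charts `Φ` reads as `L.symm`, and its inverse as `L`. -/
theorem contMDiff_transport (n : ℕ∞ω) :
    letI := transportCharts I L Φ
    ContMDiff 𝓘(ℝ, V) I n Φ := by
  let := transportCharts I L Φ
  intro y
  rw [contMDiffAt_iff]
  refine ⟨Φ.continuous.continuousAt, ?_⟩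
  refine ContDiffAt.contDiffWithinAt ?_
  refine (L.symm.contDiff.contDiffAt (n := n)).congr_of_eventuallyEq ?_
  have hc : chartAt V y = Φ.toOpenPartialHomeomorph ≫ₕ
    (chartAt H (Φ y) ≫ₕ (modelHomeo I L).toOpenPartialHomeomorph) := rfl
  filter_upwards [extChartAt_target_mem_nhds (I := 𝓘(ℝ, V)) y] with v hv
  have : I.symm (L.symm v) ∈ (chartAt H (Φ y)).target := by
    simpa [extChartAt, hc, modelHomeo, ModelWithCorners.toHomeomorph] using hv
  simp [extChartAt, hc, modelHomeo, ModelWithCorners.toHomeomorph, this, I.right_inv,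
    I.range_eq_univ]

theorem contMDiff_transport_symm (n : ℕ∞ω) :
    letI := transportCharts I L Φ
    ContMDiff I 𝓘(ℝ, V) n Φ.symm := by
  let := transportCharts I L Φ
  intro y
  rw [contMDiffAt_iff]
  refine ⟨Φ.symm.continuous.continuousAt, ?_⟩
  refine ContDiffAt.contDiffWithinAt ?_
  refine (L.contDiff.contDiffAt (n := n)).congr_of_eventuallyEq ?_
  have hc : chartAt V (Φ.symm y) = Φ.toOpenPartialHomeomorph ≫ₕ
    (chartAt H (Φ (Φ.symm y)) ≫ₕ (modelHomeo I L).toOpenPartialHomeomorph) := rfl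
  rw [Φ.apply_symm_apply] at hc
  filter_upwards [extChartAt_target_mem_nhds (I := I) y] with v hv
  have : I.symm v ∈ (chartAt H y).target := by
    simpa [extChartAt, I.range_eq_univ] using hv
  simp [extChartAt, hc, modelHomeo, ModelWithCorners.toHomeomorph, this, I.right_inv,
    I.range_eq_univ]

end Transport

end ToricHK

end

noncomputable section

namespace ToricHK

/-! ### Splitting the integer kernel of `A` -/

section Lattice

variable {m n d : ℕ}

/-- The real matrix with the entries of an integer matrix. -/
abbrev realMat (P : Matrix (Fin m) (Fin n) ℤ) : Matrix (Fin m) (Fin n) ℝ :=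
  P.map (Int.cast : ℤ → ℝ)

theorem realMat_mul {k : ℕ} (P : Matrix (Fin m) (Fin n) ℤ) (Q : Matrix (Fin n) (Fin k) ℤ) :
    realMat P * realMat Q = realMat (P * Q) :=
  (Matrix.map_mul (f := Int.castRingHom ℝ)).symm

theorem realMat_one : realMat (1 : Matrix (Fin n) (Fin n) ℤ) = 1 :=
  Matrix.map_one _ Int.cast_zero Int.cast_one

theorem realMat_zero : realMat (0 : Matrix (Fin m) (Fin n) ℤ) = 0 :=
  Matrix.map_zero _ Int.cast_zero

/-- Integer matrices `B`, `C` exhibiting `ker A` as a direct summand of `ℤ^d`: the rows of `B` form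
a basis of `ker A` and `C` is a right inverse of `B`. -/
structure IsSplitting (A : Matrix (Fin m) (Fin d) ℤ) (B : Matrix (Fin n) (Fin d) ℤ)
    (C : Matrix (Fin d) (Fin n) ℤ) : Prop where
  mul_eq_one : B * C = 1
  mul_transpose : A * Bᵀ = 0
  ker_left : ∀ x : Fin d → ℝ, realMat A *ᵥ x = 0 →
    ∃ s, x = (realMat B)ᵀ *ᵥ s
  ker_right : ∀ x : Fin d → ℝ, realMat B *ᵥ x = 0 →
    ∃ t, x = (realMat A)ᵀ *ᵥ t

/-- The image of `A` in `ℤ^m` is free, so `A` splits over its image and `ker A` is a direct summand.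
The rows of `B` are a basis of the kernel; `C` records the coordinates of the projection onto it.
Only rank-nullity enters, whence an inequality for `k`. -/
theorem exists_lattice_splitting (A : Matrix (Fin m) (Fin d) ℤ) :
    ∃ (k : ℕ) (B : Matrix (Fin k) (Fin d) ℤ) (C : Matrix (Fin d) (Fin k) ℤ),
      d ≤ m + k ∧ B * C = 1 ∧ A * Bᵀ = 0 := by
  obtain ⟨g, hg⟩ := Module.projective_lifting_property A.mulVecLin.rangeRestrict LinearMap.id
    A.mulVecLin.surjective_rangeRestrict
  have hg' (y) : A *ᵥ g y = y.1 := by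
    simpa [Subtype.ext_iff] using LinearMap.congr_fun hg y
  let K := LinearMap.ker A.mulVecLin
  -- With `g` a section of `A` over its image, `x - g (A x)` is the projection onto the kernel.
  let p : (Fin d → ℤ) →ₗ[ℤ] K := LinearMap.codRestrict K
    (LinearMap.id - g ∘ₗ A.mulVecLin.rangeRestrict) (by
      intro x
      simp [K, Matrix.mulVec_sub, hg'])
  have hp (x : K) : p x = x := by
    have h0 : A.mulVecLin.rangeRestrict x.1 = 0 := Subtype.ext x.2
    apply Subtype.ext
    simp [p, h0]
  let v := Module.finBasis ℤ K
  refine ⟨Module.finrank ℤ K, Matrix.of fun j => (v j).1,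
    Matrix.of fun i j => v.repr (p (Pi.single i 1)) j, ?_, ?_, ?_⟩
  · have h := Submodule.finrank_quotient_add_finrank (LinearMap.ker A.mulVecLin)
    rw [A.mulVecLin.quotKerEquivRange.finrank_eq] at h
    have h' := Submodule.finrank_le (LinearMap.range A.mulVecLin)
    simp only [Module.finrank_pi, Fintype.card_fin] at h h'
    exact h.ge.trans (Nat.add_le_add_right h' _)
  · ext j k
    have h1 : (∑ i, (v j).1 i • (Pi.single i 1 : Fin d → ℤ)) = (v j).1 := by
      ext i; simp [Finset.sum_apply, Pi.single_apply]
    have h2 : v.repr (p (v j).1) k = (1 : Matrix _ _ ℤ) j k := by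
      simp [hp, Finsupp.single_apply, Matrix.one_apply]
    rw [← h2, ← h1, map_sum, map_sum, Finsupp.finsetSum_apply, Matrix.mul_apply]
    exact Finset.sum_congr rfl fun i _ => by
      rw [map_smul, map_smul, Finsupp.smul_apply, smul_eq_mul]; rfl
  · ext k j
    exact congrFun (LinearMap.mem_ker.1 (v j).2) k

theorem finrank_ker_of_linearIndependent (hd : m + n = d) {A : Matrix (Fin m) (Fin d) ℝ}
    (hA : LinearIndependent ℝ A.row) :
    Module.finrank ℝ (LinearMap.ker A.mulVecLin) = n := by
  have h := LinearMap.finrank_range_add_finrank_ker A.mulVecLin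
  have hr : Module.finrank ℝ (LinearMap.range A.mulVecLin) = m := by
    simpa [Matrix.rank] using hA.rank_matrix
  simp only [Module.finrank_pi, Fintype.card_fin] at h
  lia

theorem exists_isSplitting (hd : m + n = d) (A : Matrix (Fin m) (Fin d) ℤ)
    (hA : LinearIndependent ℝ (realMat A).row) :
    ∃ (B : Matrix (Fin n) (Fin d) ℤ) (C : Matrix (Fin d) (Fin n) ℤ), IsSplitting A B C := by
  obtain ⟨k, B, C, hk, hBC, hAB⟩ := exists_lattice_splitting A
  set A' : Matrix (Fin m) (Fin d) ℝ := realMat A with hA'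
  set B' : Matrix (Fin k) (Fin d) ℝ := realMat B with hB'
  set C' : Matrix (Fin d) (Fin k) ℝ := realMat C with hC'
  have hBC' : B' * C' = 1 := by
    rw [hB', hC', realMat_mul, hBC, realMat_one]
  have hAB' : A' * B'ᵀ = 0 := by
    rw [hA', hB', ← Matrix.transpose_map, realMat_mul, hAB, realMat_zero]
  have hinj : Function.Injective B'ᵀ.mulVecLin := by
    refine Function.LeftInverse.injective (g := C'ᵀ.mulVecLin) fun s => ?_
    rw [Matrix.mulVecLin_apply, Matrix.mulVecLin_apply, Matrix.mulVec_mulVec,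
      ← Matrix.transpose_mul, hBC', Matrix.transpose_one, Matrix.one_mulVec]
  have hker := finrank_ker_of_linearIndependent hd hA
  have hle : LinearMap.range B'ᵀ.mulVecLin ≤ LinearMap.ker A'.mulVecLin := by
    rintro _ ⟨s, rfl⟩
    rw [LinearMap.mem_ker, Matrix.mulVecLin_apply, Matrix.mulVecLin_apply, Matrix.mulVec_mulVec,
      hAB', Matrix.zero_mulVec]
  have hrk := LinearMap.finrank_range_of_inj hinj
  simp only [Module.finrank_pi, Fintype.card_fin] at hrk
  -- The inclusion of the row space of `B` in the real kernel gives `k ≤ n`; the lattice inequality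
  -- `d ≤ m + k` gives the converse.
  have hkn : k = n := by
    have := Submodule.finrank_mono hle
    lia
  subst hkn
  have heq := Submodule.eq_of_le_of_finrank_eq hle (by rw [hrk, hker])
  have hsurj : LinearMap.range B'.mulVecLin = ⊤ := by
    refine LinearMap.range_eq_top.2 (Function.RightInverse.surjective (g := C'.mulVecLin) ?_)
    intro s
    simp [Matrix.mulVec_mulVec, hBC']
  have hle2 : LinearMap.range A'ᵀ.mulVecLin ≤ LinearMap.ker B'.mulVecLin := by
    rintro _ ⟨s, rfl⟩
    have : B' * A'ᵀ = 0 := by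
      rw [← Matrix.transpose_transpose B', ← Matrix.transpose_mul, hAB', Matrix.transpose_zero]
    rw [LinearMap.mem_ker, Matrix.mulVecLin_apply, Matrix.mulVecLin_apply, Matrix.mulVec_mulVec,
      this, Matrix.zero_mulVec]
  have hr2 : Module.finrank ℝ (LinearMap.range A'ᵀ.mulVecLin) = m := by
    have := hA.rank_matrix
    rw [← Matrix.rank_transpose] at this
    simpa [Matrix.rank] using this
  have hk2 : Module.finrank ℝ (LinearMap.ker B'.mulVecLin) = m := by
    have h := LinearMap.finrank_range_add_finrank_ker B'.mulVecLin
    rw [hsurj, finrank_top] at h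
    simp only [Module.finrank_pi, Fintype.card_fin] at h
    lia
  have heq2 := Submodule.eq_of_le_of_finrank_eq hle2 (by rw [hr2, hk2])
  refine ⟨B, C, hBC, hAB, fun x hx => ?_, fun x hx => ?_⟩
  · have : x ∈ LinearMap.ker A'.mulVecLin := hx
    rw [← heq] at this
    obtain ⟨s, hs⟩ := this
    exact ⟨s, hs.symm⟩
  · have : x ∈ LinearMap.ker B'.mulVecLin := hx
    rw [← heq2] at this
    obtain ⟨s, hs⟩ := this
    exact ⟨s, hs.symm⟩

namespace IsSplitting

variable {A : Matrix (Fin m) (Fin d) ℤ} {B : Matrix (Fin n) (Fin d) ℤ}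
  {C : Matrix (Fin d) (Fin n) ℤ} 

theorem real_mul_eq_one (h : IsSplitting A B C) :
    realMat B * realMat C = 1 := by
  rw [realMat_mul, h.mul_eq_one, realMat_one]

theorem real_transpose_mul (h : IsSplitting A B C) :
    (realMat C)ᵀ * (realMat B)ᵀ = 1 := by
  rw [← Matrix.transpose_mul, h.real_mul_eq_one, Matrix.transpose_one]

theorem real_mul_transpose (h : IsSplitting A B C) :
    realMat A * (realMat B)ᵀ = 0 := by
  rw [← Matrix.transpose_map, realMat_mul, h.mul_transpose, realMat_zero]

theorem real_mul_transpose' (h : IsSplitting A B C) :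
    realMat B * (realMat A)ᵀ = 0 := by
  rw [← Matrix.transpose_transpose (realMat B), ← Matrix.transpose_mul, h.real_mul_transpose,
    Matrix.transpose_zero]

end IsSplitting

end Lattice

/-! ### Monomial homomorphisms of tori -/

section Monomial

variable {k d n : ℕ}

/-- The homomorphism of tori with exponent matrix `B`. -/
def monomial (B : Matrix (Fin n) (Fin d) ℤ) : Torus d →* Torus n where
  toFun ζ j := ∏ i, ζ i ^ B j i
  map_one' := by ext; simp
  map_mul' ζ ξ := by
    funext j
    simp [mul_zpow, Finset.prod_mul_distrib]

theorem monomial_apply (B : Matrix (Fin n) (Fin d) ℤ) (ζ : Torus d) (j : Fin n) :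
    monomial B ζ j = ∏ i, ζ i ^ B j i := rfl

theorem zpow_sum {G ι : Type*} [CommGroup G] (g : G) (s : Finset ι) (f : ι → ℤ) :
    g ^ ∑ i ∈ s, f i = ∏ i ∈ s, g ^ f i :=
  congrArg Additive.toMul (Finset.sum_smul (s := s) (f := f) (x := Additive.ofMul g))

theorem circle_exp_sum {ι : Type*} (s : Finset ι) (f : ι → ℝ) :
    Circle.exp (∑ i ∈ s, f i) = ∏ i ∈ s, Circle.exp (f i) :=
  congrArg Additive.toMul (map_sum Circle.expHom f s)

theorem monomial_monomial (B : Matrix (Fin n) (Fin d) ℤ) (C : Matrix (Fin d) (Fin k) ℤ)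
    (ξ : Torus k) : monomial B (monomial C ξ) = monomial (B * C) ξ := by
  funext j
  simp only [monomial_apply, Matrix.mul_apply, ← Finset.prod_zpow, ← zpow_mul]
  rw [Finset.prod_comm]
  refine Finset.prod_congr rfl fun l _ => ?_
  rw [zpow_sum]
  exact Finset.prod_congr rfl fun i _ => by rw [mul_comm]

theorem monomial_one (ξ : Torus n) : monomial 1 ξ = ξ := by
  funext j
  rw [monomial_apply, Finset.prod_eq_single j] <;> simp +contextual [eq_comm]

theorem monomial_exp (B : Matrix (Fin n) (Fin d) ℤ) (θ : Fin d → ℝ) :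
    monomial B (fun i => Circle.exp (θ i)) =
      fun j => Circle.exp ((realMat B *ᵥ θ) j) := by
  funext j
  simp [monomial_apply, Matrix.mulVec, dotProduct, circle_exp_sum]

/-- This identifies `T^d / M` with a subgroup of `T^n`, and the section given by `C` makes it all of
`T^n`. The integral right inverse is what rules out a larger, disconnected kernel. -/
theorem IsSplitting.monomial_eq_one_iff {m : ℕ} {A : Matrix (Fin m) (Fin d) ℤ}
    {B : Matrix (Fin n) (Fin d) ℤ} {C : Matrix (Fin d) (Fin n) ℤ} (h : IsSplitting A B C)
    (ζ : Torus d) : monomial B ζ = 1 ↔ ζ ∈ subtorus A := by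
  constructor
  · intro hζ
    have hexp : (fun i => Circle.exp (ζ i : ℂ).arg) = ζ := funext fun i => Circle.exp_arg _
    set θ : Fin d → ℝ := fun i => (ζ i : ℂ).arg
    have h1 : ∀ j, ∃ k : ℤ, (realMat B *ᵥ θ) j = k * (2 * Real.pi) := fun j => by
      rw [← Circle.exp_eq_one, ← congrFun (monomial_exp B θ) j, hexp, hζ, Pi.one_apply]
    choose k hk using h1
    have hk' : realMat B *ᵥ θ = (2 * Real.pi) • fun j => (k j : ℝ) := by
      funext j; simp [hk, mul_comm]
    -- The angles satisfy `B θ = 2π k` with `k` integral. Subtracting `2π C k` moves `θ` into `ker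
    -- B` without changing its exponential, since `C k` is integral.
    obtain ⟨t, ht⟩ := h.ker_right
      (θ - (2 * Real.pi) • (realMat C *ᵥ fun j => (k j : ℝ))) (by
        rw [Matrix.mulVec_sub, Matrix.mulVec_smul, Matrix.mulVec_mulVec, h.real_mul_eq_one,
          Matrix.one_mulVec, hk', sub_self])
    refine ⟨t, fun i => ?_⟩
    have h2 := congrFun ht i
    have h3 : (∑ k, t k * (A k i : ℝ)) = θ i - 2 * Real.pi * ((∑ j, C i j * k j : ℤ) : ℝ) := by
      simp only [Matrix.mulVec, dotProduct, Matrix.transpose_apply, Matrix.map_apply,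
        Pi.sub_apply, Pi.smul_apply, smul_eq_mul] at h2
      push_cast
      rw [h2]
      exact Finset.sum_congr rfl fun _ _ => mul_comm _ _
    rw [h3, Circle.exp_sub, Circle.exp_two_pi_mul_int, div_one, ← hexp]
  · rintro ⟨t, ht⟩
    have h1 : ζ = fun i => Circle.exp (((realMat A)ᵀ *ᵥ t) i) := by
      funext i
      simp [ht, Matrix.mulVec, dotProduct, mul_comm]
    rw [h1, monomial_exp, Matrix.mulVec_mulVec, h.real_mul_transpose', Matrix.zero_mulVec]
    funext j
    simp

end Monomial

/-! ### Smoothness of monomial maps and of the phase -/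

section Smooth
variable {H : Type*} [TopologicalSpace H] {E : Type*} [NormedAddCommGroup E] [NormedSpace ℝ E]
  {I : ModelWithCorners ℝ E H} {X : Type*} [TopologicalSpace X] [ChartedSpace H X]

theorem contMDiffAt_circle_zpow {f : X → Circle} {x : X} (hf : ContMDiffAt I (𝓡 1) ∞ f x) (k : ℤ) :
    ContMDiffAt I (𝓡 1) ∞ (fun y => f y ^ k) x := by
  cases k with
  | ofNat k => simpa using hf.pow k
  | negSucc k => simpa using (hf.pow (k + 1)).inv

theorem contMDiff_monomial {n d : ℕ} (B : Matrix (Fin n) (Fin d) ℤ) :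
    ContMDiff (torusModel d) (torusModel n) ∞ (monomial B) := by
  rw [contMDiff_pi_iff]
  intro j
  have h (i : Fin d) : ContMDiff (torusModel d) (𝓡 1) ∞ (fun ζ : Torus d => ζ i ^ B j i) :=
    fun x => contMDiffAt_circle_zpow (contMDiff_eval (I := fun _ : Fin d => 𝓡 1) i x) _
  change ContMDiff (torusModel d) (𝓡 1) ∞ (fun ζ : Torus d => ∏ i, ζ i ^ B j i)
  exact contMDiff_finsetProd fun i _ => h i

/-- The direction `z / |z|` of a complex number. -/
def phase (z : ℂ) : Circle := Circle.exp z.arg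

theorem norm_mul_phase (z : ℂ) : (‖z‖ : ℂ) * phase z = z := by
  simp [phase]

theorem phase_mul_circle {z : ℂ} (hz : z ≠ 0) (u : Circle) : phase (z * u) = phase z * u := by
  have h := norm_mul_phase (z * u)
  ext
  have hz' : (‖z‖ : ℂ) ≠ 0 := by simpa
  rw [norm_mul, Circle.norm_coe, mul_one] at h
  refine mul_left_cancel₀ hz' ?_
  rw [h, Circle.coe_mul, ← mul_assoc, norm_mul_phase]

theorem phase_mul_real {r : ℝ} (hr : 0 < r) (u : Circle) : phase (r * u) = u := by
  have h := norm_mul_phase (r * u)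
  ext
  have hz' : (r : ℂ) ≠ 0 := by exact_mod_cast hr.ne'
  refine mul_left_cancel₀ hz' ?_
  simpa only [norm_mul, Circle.norm_coe, mul_one, Complex.norm_real, Real.norm_of_nonneg hr.le]
    using h

/-- The branch cut of `arg` is avoided by rotating: for `w` near `z` the quotient `w / z` is near
`1`, where `log` is smooth, and `phase w = phase (w / z) * phase z`. -/
theorem contMDiffAt_phase {z : ℂ} (hz : z ≠ 0) : ContMDiffAt 𝓘(ℝ, ℂ) (𝓡 1) ∞ phase z := by
  have h1 : ContDiffAt ℝ ∞ (fun w : ℂ => (Complex.log (w / z)).im) z := by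
    have : ContDiffAt ℝ ∞ (fun w : ℂ => Complex.log (w / z)) z := by
      refine ContDiffAt.comp z (g := Complex.log) ?_ (contDiffAt_id.div_const z)
      refine ContDiffAt.restrict_scalars ℝ (Complex.contDiffAt_log ?_)
      simp [hz]
    exact Complex.imCLM.contDiff.contDiffAt.comp z this
  have h2 : ContMDiffAt 𝓘(ℝ, ℂ) (𝓡 1) ∞
      (fun w : ℂ => phase z * Circle.exp (Complex.log (w / z)).im) z :=
    contMDiffAt_const.mul ((contMDiff_circleExp _).comp z h1.contMDiffAt)
  refine h2.congr_of_eventuallyEq ?_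
  filter_upwards [isOpen_ne.mem_nhds hz] with w hw
  have hw' : w ≠ 0 := hw
  have h3 : phase (w / z) * phase z = phase w := by
    rw [← phase_mul_circle (div_ne_zero hw' hz)]
    have h5 : w / z * (phase z : ℂ) = ((‖z‖⁻¹ * ‖w‖ : ℝ) : ℂ) * phase w := by
      have hz' : (‖z‖ : ℂ) ≠ 0 := by simpa
      push_cast
      rw [mul_assoc, norm_mul_phase, div_mul_eq_mul_div, div_eq_iff hz, mul_assoc, ← div_eq_inv_mul,
        eq_div_iff hz', mul_assoc, mul_comm (phase z : ℂ), norm_mul_phase]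
    rw [h5, phase_mul_real (by positivity)]
  rw [← h3, mul_comm, Complex.log_im]
  rfl

end Smooth
end ToricHK

end

noncomputable section

namespace ToricHK

/-! ### The modulus as a function of the real coordinate -/

section Radius

/-- The modulus of the complex number `z` determined by `z w = b` and `(|z|² - |w|²) / 2 = x`. -/
def radius (b : ℂ) (x : ℝ) : ℝ := √(x + √(x ^ 2 + ‖b‖ ^ 2))

variable {b : ℂ}

theorem sqrt_add_pos (hb : b ≠ 0) (x : ℝ) : 0 < x + √(x ^ 2 + ‖b‖ ^ 2) := by
  have h1 : |x| < √(x ^ 2 + ‖b‖ ^ 2) := by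
    rw [← Real.sqrt_sq_eq_abs]
    have : 0 < ‖b‖ := norm_pos_iff.2 hb
    exact Real.sqrt_lt_sqrt (sq_nonneg x) (by nlinarith)
  linarith [neg_abs_le x]

theorem radius_pos (hb : b ≠ 0) (x : ℝ) : 0 < radius b x := Real.sqrt_pos.2 (sqrt_add_pos hb x)

theorem radius_sq (hb : b ≠ 0) (x : ℝ) : radius b x ^ 2 = x + √(x ^ 2 + ‖b‖ ^ 2) :=
  Real.sq_sqrt (sqrt_add_pos hb x).le

theorem radius_spec (hb : b ≠ 0) (x : ℝ) :
    (radius b x ^ 2 - (‖b‖ / radius b x) ^ 2) / 2 = x := by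
  have h := sqrt_add_pos hb x
  have h2 := Real.sq_sqrt (show 0 ≤ x ^ 2 + ‖b‖ ^ 2 by positivity)
  rw [div_pow, radius_sq hb]
  field_simp
  nlinarith

/-- Put `s = ‖b‖ / r`. Since `r s = ‖b‖`, the number `x² + ‖b‖²` is the square of `(r² + s²) / 2`,
and adding `x = (r² - s²) / 2` to this leaves `r²`. -/
theorem eq_radius (hb : b ≠ 0) {r x : ℝ} (hr : 0 < r) (h : (r ^ 2 - (‖b‖ / r) ^ 2) / 2 = x) :
    r = radius b x := by
  have h1 : x ^ 2 + ‖b‖ ^ 2 = ((r ^ 2 + (‖b‖ / r) ^ 2) / 2) ^ 2 := by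
    rw [← h]; field_simp; ring
  rw [radius, h1, Real.sqrt_sq (by positivity), ← h]
  rw [show (r ^ 2 - (‖b‖ / r) ^ 2) / 2 + (r ^ 2 + (‖b‖ / r) ^ 2) / 2 = r ^ 2 by ring,
    Real.sqrt_sq hr.le]

/-- Both radicands are positive because `b ≠ 0`. On a wall the formula becomes `√(x + |x|)`, which
is not smooth at `0`. -/
theorem contDiff_radius (hb : b ≠ 0) : ContDiff ℝ ∞ (radius b) := by
  have hb' : 0 < ‖b‖ := norm_pos_iff.2 hb
  have h1 : ContDiff ℝ ∞ fun x : ℝ => √(x ^ 2 + ‖b‖ ^ 2) :=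
    ((contDiff_id.pow 2).add contDiff_const).sqrt fun x => by simp only [id]; positivity
  exact (contDiff_id.add h1).sqrt fun x => (sqrt_add_pos hb x).ne'

end Radius

/-! ### Phases and real coordinates over a point off the walls -/

section FiberPoint

variable {d : ℕ}

/-- The point of `ℍ^d` with complex coordinates `b`, angles `u` and real coordinates `x`. -/
def fiberPoint (b : Fin d → ℂ) (u : Torus d) (x : Fin d → ℝ) : HSpace d :=
  (fun i => (radius (b i) (x i) : ℂ) * u i, fun i => b i * ((radius (b i) (x i) : ℂ) * u i)⁻¹)

variable {b : Fin d → ℂ}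

theorem fiberPoint_fst_ne_zero (hb : ∀ i, b i ≠ 0) (u : Torus d) (x : Fin d → ℝ) (i : Fin d) :
    (fiberPoint b u x).1 i ≠ 0 :=
  mul_ne_zero (Complex.ofReal_ne_zero.2 (radius_pos (hb i) _).ne') (Circle.coe_ne_zero _)

theorem complexCoord_fiberPoint (hb : ∀ i, b i ≠ 0) (u : Torus d) (x : Fin d → ℝ) :
    complexCoord (fiberPoint b u x) = b := by
  funext i
  have := fiberPoint_fst_ne_zero hb u x i
  simp only [fiberPoint] at this
  simp only [complexCoord, fiberPoint]
  rw [mul_left_comm, mul_inv_cancel₀ this, mul_one]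

theorem realCoord_fiberPoint (hb : ∀ i, b i ≠ 0) (u : Torus d) (x : Fin d → ℝ) :
    realCoord (fiberPoint b u x) = x := by
  funext i
  refine Eq.trans ?_ (radius_spec (hb i) (x i))
  have hr := (radius_pos (hb i) (x i)).le
  simp only [realCoord, fiberPoint, norm_mul, norm_inv, Complex.norm_real, Circle.norm_coe,
    Real.norm_of_nonneg hr, mul_one, div_eq_mul_inv]

theorem act_fiberPoint (ζ u : Torus d) (x : Fin d → ℝ) :
    act ζ (fiberPoint b u x) = fiberPoint b (u * ζ) x := by
  ext i
  · simp [act, fiberPoint, mul_assoc]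
  · simp [act, fiberPoint]; ring

theorem phase_fiberPoint (hb : ∀ i, b i ≠ 0) (u : Torus d) (x : Fin d → ℝ) :
    (fun i => phase ((fiberPoint b u x).1 i)) = u :=
  funext fun i => phase_mul_real (radius_pos (hb i) _) _

theorem fst_ne_zero_of_complexCoord (hb : ∀ i, b i ≠ 0) {p : HSpace d} (hp : complexCoord p = b)
    (i : Fin d) : p.1 i ≠ 0 := by
  intro h
  exact hb i (by rw [← hp, complexCoord, h, zero_mul])

/-- The equation `z i * w i = b i` determines `w` from `z`, and `eq_radius` recovers `|z i|` from
the real coordinate; the phase is the only remaining datum. -/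
theorem fiberPoint_phase (hb : ∀ i, b i ≠ 0) {p : HSpace d} (hp : complexCoord p = b) :
    fiberPoint b (fun i => phase (p.1 i)) (realCoord p) = p := by
  have hz := fst_ne_zero_of_complexCoord hb hp
  have hw (i) : p.2 i = b i * (p.1 i)⁻¹ := by
    rw [← hp, complexCoord, mul_comm, inv_mul_cancel_left₀ (hz i)]
  have hr (i) : radius (b i) (realCoord p i) = ‖p.1 i‖ := by
    refine (eq_radius (hb i) (norm_pos_iff.2 (hz i)) ?_).symm
    rw [realCoord, hw, norm_mul, norm_inv, div_eq_mul_inv ‖b i‖]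
  ext i
  · simp [fiberPoint, hr, norm_mul_phase]
  · simp only [fiberPoint, hr, norm_mul_phase, hw]

theorem contDiff_realCoord : ContDiff ℝ ∞ (realCoord : HSpace d → Fin d → ℝ) := by
  rw [contDiff_pi]
  intro i
  have h1 : ContDiff ℝ ∞ fun p : HSpace d => p.1 i := (contDiff_apply ℝ ℂ i).comp contDiff_fst
  have h2 : ContDiff ℝ ∞ fun p : HSpace d => p.2 i := (contDiff_apply ℝ ℂ i).comp contDiff_snd
  exact ((h1.norm_sq ℝ).sub (h2.norm_sq ℝ)).div_const 2

theorem contMDiff_circle_coe : ContMDiff (𝓡 1) 𝓘(ℝ, ℂ) ∞ (fun u : Circle => (u : ℂ)) := by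
  have : Fact (Module.finrank ℝ ℂ = 1 + 1) := finrank_real_complex_fact'
  exact contMDiff_coe_sphere

variable {H : Type*} [TopologicalSpace H] {E : Type*} [NormedAddCommGroup E] [NormedSpace ℝ E]
  {I : ModelWithCorners ℝ E H} {X : Type*} [TopologicalSpace X] [ChartedSpace H X]

theorem contMDiff_fiberPoint (hb : ∀ i, b i ≠ 0) {u : X → Torus d} {x : X → Fin d → ℝ}
    (hu : ContMDiff I (torusModel d) ∞ u) (hx : ContMDiff I 𝓘(ℝ, Fin d → ℝ) ∞ x) :
    ContMDiff I 𝓘(ℝ, HSpace d) ∞ (fun y => fiberPoint b (u y) (x y)) := by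
  have h1 (i : Fin d) : ContMDiff I 𝓘(ℝ, ℂ) ∞ (fun y => (radius (b i) (x y i) : ℂ) * u y i) := by
    have h2 : ContMDiff I 𝓘(ℝ, ℝ) ∞ fun y => x y i := contMDiff_pi_space.1 hx i
    have h3 : ContMDiff I 𝓘(ℝ, ℂ) ∞ fun y => (radius (b i) (x y i) : ℂ) :=
      (Complex.ofRealCLM.contDiff.comp (contDiff_radius (hb i))).contMDiff.comp h2
    have h4 : ContMDiff I 𝓘(ℝ, ℂ) ∞ fun y => (u y i : ℂ) :=
      contMDiff_circle_coe.comp (contMDiff_pi_iff.1 hu i)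
    have hm : ContMDiff (𝓘(ℝ, ℂ × ℂ)) 𝓘(ℝ, ℂ) ∞ fun p : ℂ × ℂ => p.1 * p.2 :=
      contDiff_mul.contMDiff
    exact hm.comp (h3.prodMk_space h4)
  refine ContMDiff.prodMk_space (contMDiff_pi_space.2 h1) (contMDiff_pi_space.2 fun i => ?_)
  intro y
  have h5 : ContDiffAt ℝ ∞ (fun z : ℂ => b i * z⁻¹) ((radius (b i) (x y i) : ℂ) * u y i) :=
    contDiffAt_const.mul (contDiffAt_inv ℝ (fiberPoint_fst_ne_zero hb (u y) (x y) i))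
  exact ContMDiffAt.comp (g := fun z : ℂ => b i * z⁻¹) y h5.contMDiffAt (h1 i y)

end FiberPoint

/-! ### The orbit projection -/

section Quotient

variable {m d : ℕ} {A : Matrix (Fin m) (Fin d) ℤ} {α : Fin m → ℝ} {β : Fin m → ℂ}

theorem mem_levelSet_iff {p : HSpace d} : p ∈ levelSet A α β ↔
    realCoord p ∈ realSolutions A α ∧ complexCoord p ∈ complexSolutions A β := by
  have h1 : realMu A p = A.map (Int.cast : ℤ → ℝ) *ᵥ realCoord p := by
    ext k
    simp only [Matrix.mulVec, dotProduct, realCoord, realMu, Matrix.map_apply, Finset.mul_sum]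
    exact Finset.sum_congr rfl fun i _ => by ring
  have h2 : complexMu A p = A.map (Int.cast : ℤ → ℂ) *ᵥ complexCoord p := by
    ext k
    simp only [Matrix.mulVec, dotProduct, complexCoord, complexMu, Matrix.map_apply]
    exact Finset.sum_congr rfl fun i _ => by ring
  rw [levelSet, Set.mem_ofPred_eq, h1, h2]
  rfl

theorem continuous_act (ζ : Torus d) : Continuous (act ζ) := by
  unfold act
  fun_prop

theorem proj_eq_iff {p q : levelSet A α β} :
    proj p = proj q ↔ ∃ ζ ∈ subtorus A, act ζ p.1 = q.1 :=
  ⟨fun h => Quotient.exact h, fun h => Quotient.sound h⟩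

/-- The saturation of an open set is a union of its preimages under the homeomorphisms given by
elements of `M`. -/
theorem isOpenQuotientMap_proj : IsOpenQuotientMap (proj : levelSet A α β → Y A α β) := by
  refine ⟨Quotient.mk_surjective, continuous_quot_mk, fun U hU => ?_⟩
  have : IsOpen (proj ⁻¹' (proj '' U) : Set (levelSet A α β)) := by
    have h : (proj ⁻¹' (proj '' U) : Set (levelSet A α β)) = ⋃ ζ ∈ subtorus A,
        (fun p : levelSet A α β => (⟨act ζ p.1, act_mem_levelSet A ζ p.2⟩ : levelSet A α β)) ⁻¹'
          U := by
      ext p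
      simp only [Set.mem_preimage, Set.mem_image, Set.mem_iUnion, exists_prop]
      constructor
      · rintro ⟨q, hq, h⟩
        obtain ⟨ζ, hζ, h⟩ := proj_eq_iff.1 h.symm
        refine ⟨ζ, hζ, ?_⟩
        convert hq
      · rintro ⟨ζ, hζ, h⟩
        exact ⟨_, h, (proj_eq_iff.2 ⟨ζ, hζ, rfl⟩).symm⟩
    rw [h]
    exact isOpen_biUnion fun ζ _ => hU.preimage
      (((continuous_act ζ).comp continuous_subtype_val).subtype_mk _)
  exact this

end Quotient

end ToricHK

end

noncomputable section

namespace ToricHK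

variable {m n d : ℕ}

/-- The model `T^n × ℝ^n` of the fiber. -/
abbrev FiberModel (n : ℕ) : Type := Torus n × EuclideanSpace ℝ (Fin n)

/-- The model with corners of `T^n × ℝ^n`. -/
abbrev fiberModel (n : ℕ) := (torusModel n).prod (𝓡 n)

/-! ### Affine coordinates on the real solution space -/

section Affine

/-- The parametrization `s ↦ x₀ + Bᵀ s` of the real solution space. -/
def affinePoint (B : Matrix (Fin n) (Fin d) ℤ) (x₀ : Fin d → ℝ) (s : EuclideanSpace ℝ (Fin n)) :
    Fin d → ℝ :=
  x₀ + (realMat B)ᵀ *ᵥ s.ofLp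

/-- The coordinates on the real solution space. -/
def affineCoord (C : Matrix (Fin d) (Fin n) ℤ) (x₀ x : Fin d → ℝ) : EuclideanSpace ℝ (Fin n) :=
  WithLp.toLp 2 ((realMat C)ᵀ *ᵥ (x - x₀))

theorem contDiff_mulVec {p q : ℕ} (P : Matrix (Fin p) (Fin q) ℝ) :
    ContDiff ℝ ∞ fun x : Fin q → ℝ => P *ᵥ x :=
  (LinearMap.toContinuousLinearMap P.mulVecLin).contDiff

theorem contDiff_affinePoint (B : Matrix (Fin n) (Fin d) ℤ) (x₀ : Fin d → ℝ) :
    ContDiff ℝ ∞ (affinePoint B x₀) :=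
  contDiff_const.add ((contDiff_mulVec _).comp (EuclideanSpace.equiv (Fin n) ℝ).contDiff)

theorem contDiff_affineCoord (C : Matrix (Fin d) (Fin n) ℤ) (x₀ : Fin d → ℝ) :
    ContDiff ℝ ∞ (affineCoord C x₀) :=
  (EuclideanSpace.equiv (Fin n) ℝ).symm.contDiff.comp
    ((contDiff_mulVec _).comp (contDiff_id.sub contDiff_const))

variable {A : Matrix (Fin m) (Fin d) ℤ} {B : Matrix (Fin n) (Fin d) ℤ}
  {C : Matrix (Fin d) (Fin n) ℤ} {α : Fin m → ℝ} {x₀ : Fin d → ℝ}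

theorem mem_realSolutions_iff {x : Fin d → ℝ} : x ∈ realSolutions A α ↔ realMat A *ᵥ x = α :=
  Iff.rfl

theorem affinePoint_mem (hs : IsSplitting A B C) (hx₀ : x₀ ∈ realSolutions A α)
    (s : EuclideanSpace ℝ (Fin n)) : affinePoint B x₀ s ∈ realSolutions A α := by
  rw [mem_realSolutions_iff] at *
  rw [affinePoint, Matrix.mulVec_add, Matrix.mulVec_mulVec, hs.real_mul_transpose,
    Matrix.zero_mulVec, hx₀, add_zero]

theorem affineCoord_affinePoint (hs : IsSplitting A B C) (s : EuclideanSpace ℝ (Fin n)) :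
    affineCoord C x₀ (affinePoint B x₀ s) = s := by
  rw [affineCoord, affinePoint, add_sub_cancel_left, Matrix.mulVec_mulVec, hs.real_transpose_mul,
    Matrix.one_mulVec]

theorem affinePoint_affineCoord (hs : IsSplitting A B C) (hx₀ : x₀ ∈ realSolutions A α)
    {x : Fin d → ℝ} (hx : x ∈ realSolutions A α) :
    affinePoint B x₀ (affineCoord C x₀ x) = x := by
  rw [mem_realSolutions_iff] at *
  obtain ⟨s, h⟩ := hs.ker_left (x - x₀) (by rw [Matrix.mulVec_sub, hx, hx₀, sub_self])
  have h1 : (realMat C)ᵀ *ᵥ (x - x₀) = s := by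
    rw [h, Matrix.mulVec_mulVec, hs.real_transpose_mul, Matrix.one_mulVec]
  rw [affineCoord, affinePoint, h1, ← h, add_sub_cancel]

end Affine

/-! ### The homeomorphism of the fiber with `T^n × ℝ^n` -/

section Coordinates

/-- The map to `T^n × ℝ^n` on the flat space which induces the coordinates on the fiber. -/
def flatCoord (B : Matrix (Fin n) (Fin d) ℤ) (C : Matrix (Fin d) (Fin n) ℤ) (x₀ : Fin d → ℝ)
    (p : HSpace d) : FiberModel n :=
  (monomial B fun i => phase (p.1 i), affineCoord C x₀ (realCoord p))

theorem contMDiffAt_flatCoord (B : Matrix (Fin n) (Fin d) ℤ) (C : Matrix (Fin d) (Fin n) ℤ)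
    (x₀ : Fin d → ℝ) {p : HSpace d} (hp : ∀ i, p.1 i ≠ 0) :
    ContMDiffAt 𝓘(ℝ, HSpace d) (fiberModel n) ∞ (flatCoord B C x₀) p := by
  refine ContMDiffAt.prodMk ?_ ?_
  · have h : ContMDiffAt 𝓘(ℝ, HSpace d) (torusModel d) ∞
        (fun p : HSpace d => fun i => phase (p.1 i)) p := by
      rw [contMDiffAt_pi_iff]
      intro i
      have h1 : ContDiff ℝ ∞ fun p : HSpace d => p.1 i := (contDiff_apply ℝ ℂ i).comp contDiff_fst
      exact ContMDiffAt.comp (g := phase) p (contMDiffAt_phase (hp i)) h1.contMDiff.contMDiffAt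
    exact (contMDiff_monomial B _).comp p h
  · exact ((contDiff_affineCoord C x₀).comp contDiff_realCoord).contMDiff.contMDiffAt

/-- The parametrization of the fiber, as a map into the flat space. -/
def flatPoint (B : Matrix (Fin n) (Fin d) ℤ) (C : Matrix (Fin d) (Fin n) ℤ) (x₀ : Fin d → ℝ)
    (b : Fin d → ℂ) (q : FiberModel n) : HSpace d :=
  fiberPoint b (monomial C q.1) (affinePoint B x₀ q.2)

variable {A : Matrix (Fin m) (Fin d) ℤ} {B : Matrix (Fin n) (Fin d) ℤ}
  {C : Matrix (Fin d) (Fin n) ℤ} {α : Fin m → ℝ} {β : Fin m → ℂ} {x₀ : Fin d → ℝ} {b : Fin d → ℂ}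

theorem contMDiff_flatPoint (hb : ∀ i, b i ≠ 0) :
    ContMDiff (fiberModel n) 𝓘(ℝ, HSpace d) ∞ (flatPoint B C x₀ b) :=
  contMDiff_fiberPoint hb ((contMDiff_monomial C).comp contMDiff_fst)
    ((contDiff_affinePoint B x₀).contMDiff.comp contMDiff_snd)

open Classical in
/-- The coordinates in `T^n × ℝ^n` on the quotient `Y(α, β)`, with a junk value where some `z i`
vanishes. -/
def quotientCoord (hs : IsSplitting A B C) (x₀ : Fin d → ℝ) (y : Y A α β) : FiberModel n :=
  Quotient.liftOn y (fun p => if ∀ i, p.1.1 i ≠ 0 then flatCoord B C x₀ p.1 else (1, 0)) (by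
    rintro p q ⟨ζ, hζ, h⟩
    have h1 : (∀ i, p.1.1 i ≠ 0) ↔ ∀ i, q.1.1 i ≠ 0 := by
      simp [← h, act]
    by_cases h2 : ∀ i, p.1.1 i ≠ 0
    · rw [if_pos h2, if_pos (h1.1 h2)]
      refine Prod.ext ?_ ?_
      · have h3 : (fun i => phase (q.1.1 i)) = (fun i => phase (p.1.1 i)) * ζ := by
          funext i
          rw [← h]
          exact phase_mul_circle (h2 i) _
        change monomial B _ = monomial B _
        rw [h3, map_mul, (hs.monomial_eq_one_iff ζ).2 hζ, mul_one]
      · change affineCoord C x₀ _ = affineCoord C x₀ _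
        rw [← h, realCoord_act]
    · rw [if_neg h2, if_neg (mt h1.2 h2)])

theorem quotientCoord_proj (hs : IsSplitting A B C) {p : levelSet A α β}
    (hp : ∀ i, p.1.1 i ≠ 0) : quotientCoord hs x₀ (proj p) = flatCoord B C x₀ p.1 :=
  if_pos hp

theorem eventually_fst_ne_zero {p : HSpace d} (hp : ∀ i, p.1 i ≠ 0) :
    ∀ᶠ q : HSpace d in 𝓝 p, ∀ i, q.1 i ≠ 0 :=
  Filter.eventually_all.2 fun i =>
    (((continuous_apply i).comp continuous_fst).continuousAt).eventually_ne (hp i)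

/-- Since `proj` is an open quotient map, continuity may be tested on the level set, where the
coordinates agree with `flatCoord` near `p`. -/
theorem continuousAt_quotientCoord (hs : IsSplitting A B C) {p : levelSet A α β}
    (hp : ∀ i, p.1.1 i ≠ 0) : ContinuousAt (quotientCoord hs x₀) (proj p) := by
  rw [← isOpenQuotientMap_proj.continuousAt_comp_iff]
  have h : ContinuousAt (fun p : levelSet A α β => flatCoord B C x₀ p.1) p :=
    (contMDiffAt_flatCoord B C x₀ hp).continuousAt.comp continuousAt_subtype_val
  refine h.congr ?_
  filter_upwards [continuousAt_subtype_val.eventually (eventually_fst_ne_zero hp)] with q hq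
  exact (quotientCoord_proj hs hq).symm

theorem flatPoint_mem (hs : IsSplitting A B C) (hb : ∀ i, b i ≠ 0) (hβ : b ∈ complexSolutions A β)
    (hx₀ : x₀ ∈ realSolutions A α) (q : FiberModel n) : flatPoint B C x₀ b q ∈ levelSet A α β := by
  rw [mem_levelSet_iff, flatPoint, realCoord_fiberPoint hb, complexCoord_fiberPoint hb]
  exact ⟨affinePoint_mem hs hx₀ _, hβ⟩

theorem flatCoord_flatPoint (hs : IsSplitting A B C) (hb : ∀ i, b i ≠ 0) (q : FiberModel n) :
    flatCoord B C x₀ (flatPoint B C x₀ b q) = q := by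
  rw [flatCoord, flatPoint, phase_fiberPoint hb, monomial_monomial, hs.mul_eq_one, monomial_one,
    realCoord_fiberPoint hb, affineCoord_affinePoint hs]

theorem fiber_rep (y : Fiber A α β b) :
    ∃ p : levelSet A α β, ∃ h : complexCoord p.1 = b, y = ⟨proj p, h⟩ := by
  obtain ⟨⟨p⟩, hy⟩ := y
  exact ⟨p, hy, rfl⟩

/-- The homeomorphism of the fiber with `T^n × ℝ^n`. -/
def fiberHomeo (hs : IsSplitting A B C) (hb : ∀ i, b i ≠ 0) (hβ : b ∈ complexSolutions A β)
    (hx₀ : x₀ ∈ realSolutions A α) : Fiber A α β b ≃ₜ FiberModel n where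
  toFun y := quotientCoord hs x₀ y.1
  invFun q := ⟨proj ⟨flatPoint B C x₀ b q, flatPoint_mem hs hb hβ hx₀ q⟩,
    complexCoord_fiberPoint hb _ _⟩
  left_inv y := by
    obtain ⟨p, hp, rfl⟩ := fiber_rep y
    refine Subtype.ext (proj_eq_iff.2 ?_)
    have hz := fst_ne_zero_of_complexCoord hb hp
    set u : Torus d := fun i => phase (p.1.1 i) with hu
    -- The reconstructed point has phases `monomial C (monomial B u)` instead of `u`. The
    -- discrepancy is killed by `monomial B`, as `B * C = 1`, so it lies in `M`.
    refine ⟨(monomial C (monomial B u))⁻¹ * u, ?_, ?_⟩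
    · rw [← hs.monomial_eq_one_iff, map_mul, map_inv, monomial_monomial, hs.mul_eq_one,
        monomial_one, inv_mul_cancel]
    · dsimp only
      rw [quotientCoord_proj hs hz, flatPoint, act_fiberPoint, flatCoord,
        affinePoint_affineCoord hs hx₀ (mem_levelSet_iff.1 p.2).1, ← hu, mul_inv_cancel_left, hu,
        fiberPoint_phase hb hp]
  right_inv q := by
    dsimp only
    rw [quotientCoord_proj hs (fiberPoint_fst_ne_zero hb _ _), flatCoord_flatPoint hs hb]
  continuous_toFun := by
    rw [continuous_iff_continuousAt]
    intro y
    obtain ⟨p, hp, rfl⟩ := fiber_rep y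
    exact (continuousAt_quotientCoord hs (fst_ne_zero_of_complexCoord hb hp)).comp
      (f := Subtype.val) (x := (⟨proj p, hp⟩ : Fiber A α β b)) continuousAt_subtype_val
  continuous_invFun :=
    (isOpenQuotientMap_proj.continuous.comp
      ((contMDiff_flatPoint hb).continuous.subtype_mk _)).subtype_mk _

section FiberHomeo

variable (hs : IsSplitting A B C) (hb : ∀ i, b i ≠ 0) (hβ : b ∈ complexSolutions A β)
  (hx₀ : x₀ ∈ realSolutions A α)

theorem fiberHomeo_proj {p : levelSet A α β} (hp : complexCoord p.1 = b) :
    fiberHomeo hs hb hβ hx₀ ⟨proj p, hp⟩ = flatCoord B C x₀ p.1 :=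
  quotientCoord_proj hs (fst_ne_zero_of_complexCoord hb hp)

theorem fiberHomeo_smul (ζ : Torus d) (y : Fiber A α β b) :
    fiberHomeo hs hb hβ hx₀ ((ζ : Torus d ⧸ subtorus A) • y) =
      (monomial B ζ * (fiberHomeo hs hb hβ hx₀ y).1, (fiberHomeo hs hb hβ hx₀ y).2) := by
  obtain ⟨p, hp, rfl⟩ := fiber_rep y
  have hp' : complexCoord (act ζ p.1) = b := (complexCoord_act ζ p.1).trans hp
  refine (fiberHomeo_proj hs hb hβ hx₀ (p := ⟨act ζ p.1, act_mem_levelSet A ζ p.2⟩) hp').trans ?_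
  rw [fiberHomeo_proj, flatCoord, flatCoord, realCoord_act, ← map_mul]
  congr 2
  funext i
  exact (phase_mul_circle (fst_ne_zero_of_complexCoord hb hp i) _).trans (mul_comm _ _)

theorem realMoment_eq (y : Fiber A α β b) :
    realMoment y.1 = affinePoint B x₀ (fiberHomeo hs hb hβ hx₀ y).2 := by
  obtain ⟨p, hp, rfl⟩ := fiber_rep y
  rw [fiberHomeo_proj, flatCoord, affinePoint_affineCoord hs hx₀ (mem_levelSet_iff.1 p.2).1]
  rfl

include hs hb hβ hx₀ in
theorem range_realMoment :
    Set.range (fun y : Fiber A α β b => realMoment y.1) = realSolutions A α := by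
  refine Set.Subset.antisymm (Set.range_subset_iff.2 fun y => realMoment_mem y.1) fun x hx => ?_
  refine ⟨(fiberHomeo hs hb hβ hx₀).symm (1, affineCoord C x₀ x), ?_⟩
  dsimp only
  rw [realMoment_eq hs hb hβ hx₀, Homeomorph.apply_symm_apply, affinePoint_affineCoord hs hx₀ hx]

-- The action is translation by `monomial B ζ` on the group `T^n`, so a fixed point forces `ζ` into
-- the kernel, which is `M`.
include hs hb in
theorem eq_one_of_smul_eq (hβ : b ∈ complexSolutions A β) (hx₀ : x₀ ∈ realSolutions A α)
    (g : Torus d ⧸ subtorus A) (y : Fiber A α β b) (h : g • y = y) : g = 1 := by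
  induction g using Quotient.inductionOn with
  | h ζ =>
    have h1 := congrArg (fun y => (fiberHomeo hs hb hβ hx₀ y).1) h
    have h2 := fiberHomeo_smul hs hb hβ hx₀ ζ y
    have h3 : monomial B ζ * (fiberHomeo hs hb hβ hx₀ y).1 = (fiberHomeo hs hb hβ hx₀ y).1 :=
      (congrArg Prod.fst h2).symm.trans h1
    exact (QuotientGroup.eq_one_iff ζ).2 ((hs.monomial_eq_one_iff ζ).1 (mul_eq_right.1 h3))

end FiberHomeo

end Coordinates

end ToricHK

end

noncomputable section

namespace ToricHK

variable {m n d : ℕ} {A : Matrix (Fin m) (Fin d) ℤ} {B : Matrix (Fin n) (Fin d) ℤ}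
  {C : Matrix (Fin d) (Fin n) ℤ} {α : Fin m → ℝ} {β : Fin m → ℂ} {x₀ : Fin d → ℝ} {b : Fin d → ℂ}

/-! ### An invariant cutoff away from vanishing `z i` -/

section Cutoff

/-- A torus-invariant smooth function which vanishes where some `|z i|² ≤ c i / 4` and equals `1`
where all `|z i|² ≥ c i / 2`. -/
def cutoff (c : Fin d → ℝ) (p : HSpace d) : ℝ :=
  ∏ i, Real.smoothTransition (4 * ‖p.1 i‖ ^ 2 / c i - 1)

theorem contDiff_cutoff (c : Fin d → ℝ) : ContDiff ℝ ∞ (cutoff c) := by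
  refine contDiff_prod fun i _ => Real.smoothTransition.contDiff.comp ?_
  have h1 : ContDiff ℝ ∞ fun p : HSpace d => p.1 i := (contDiff_apply ℝ ℂ i).comp contDiff_fst
  exact ((contDiff_const.mul (h1.norm_sq ℝ)).div_const _).sub contDiff_const

theorem cutoff_act (c : Fin d → ℝ) (ζ : Torus d) (p : HSpace d) :
    cutoff c (act ζ p) = cutoff c p := by
  simp only [cutoff, act, norm_mul, Circle.norm_coe, mul_one]

/-- The cutoff function on the quotient. -/
def quotientCutoff (c : Fin d → ℝ) (y : Y A α β) : ℝ :=
  Quotient.liftOn y (fun p => cutoff c p.1) (by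
    rintro p q ⟨ζ, _, h⟩
    rw [← h, cutoff_act])

theorem quotientCutoff_proj (c : Fin d → ℝ) (p : levelSet A α β) :
    quotientCutoff c (proj p) = cutoff c p.1 := rfl

theorem cutoff_eq_zero {c : Fin d → ℝ} {p : HSpace d} {i : Fin d} (hc : 0 < c i)
    (h : ‖p.1 i‖ ^ 2 < c i / 4) : cutoff c p = 0 := by
  refine Finset.prod_eq_zero (Finset.mem_univ i) (Real.smoothTransition.zero_of_nonpos ?_)
  rw [sub_nonpos, div_le_one hc]
  linarith

theorem cutoff_eq_one {c : Fin d → ℝ} {p : HSpace d} (hc : ∀ i, 0 < c i)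
    (h : ∀ i, c i / 2 < ‖p.1 i‖ ^ 2) : cutoff c p = 1 := by
  refine Finset.prod_eq_one fun i _ => Real.smoothTransition.one_of_one_le ?_
  rw [le_sub_iff_add_le, le_div_iff₀ (hc i)]
  linarith [h i]

theorem continuous_norm_fst_sq (i : Fin d) : Continuous fun p : HSpace d => ‖p.1 i‖ ^ 2 := by
  fun_prop

end Cutoff

/-! ### Smooth functions on the fiber and in coordinates -/

section SmoothFunctions

variable (hs : IsSplitting A B C) (hb : ∀ i, b i ≠ 0) (hβ : b ∈ complexSolutions A β)
  (hx₀ : x₀ ∈ realSolutions A α)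

/-- Where all `z i` are nonzero both factors have smooth lifts. Near a point with some `z i = 0` the
cutoff vanishes identically, so the junk value of `quotientCoord` is harmless. -/
theorem isSmoothFun_cutoff_mul {c : Fin d → ℝ} (hc : ∀ i, 0 < c i) {F : FiberModel n → ℝ}
    (hF : ContMDiff (fiberModel n) 𝓘(ℝ, ℝ) ∞ F) :
    IsSmoothFun (fun y : Y A α β => quotientCutoff c y * F (quotientCoord hs x₀ y)) := by
  intro p
  by_cases hp : ∀ i, p.1.1 i ≠ 0
  · refine ⟨{q | ∀ i, q.1 i ≠ 0}, fun q => cutoff c q * F (flatCoord B C x₀ q), ?_, hp, ?_, ?_⟩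
    · exact isOpen_iff_eventually.2 fun q hq => eventually_fst_ne_zero hq
    · intro q hq
      refine ContDiffAt.contDiffWithinAt ?_
      refine (contDiff_cutoff c).contDiffAt.mul (contMDiffAt_iff_contDiffAt.1 ?_)
      exact (hF _).comp q (contMDiffAt_flatCoord B C x₀ hq)
    · intro q hq
      dsimp only
      rw [quotientCoord_proj hs hq, quotientCutoff_proj]
  · push Not at hp
    obtain ⟨i, hi⟩ := hp
    refine ⟨{q | ‖q.1 i‖ ^ 2 < c i / 4}, fun _ => 0,
      isOpen_lt (continuous_norm_fst_sq i) continuous_const, ?_, contDiffOn_const, ?_⟩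
    · rw [Set.mem_ofPred_eq, hi, norm_zero]
      linarith [hc i]
    · intro q hq
      dsimp only
      rw [quotientCutoff_proj, cutoff_eq_zero (hc i) hq, zero_mul]

theorem isSmoothFunOnFiber_comp {F : FiberModel n → ℝ}
    (hF : ContMDiff (fiberModel n) 𝓘(ℝ, ℝ) ∞ F) :
    IsSmoothFunOnFiber (fun y : Fiber A α β b => F (fiberHomeo hs hb hβ hx₀ y)) := by
  intro y
  obtain ⟨p, hp, rfl⟩ := fiber_rep y
  have hz := fst_ne_zero_of_complexCoord hb hp
  have hc (i) : 0 < ‖p.1.1 i‖ ^ 2 := by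
    have := norm_pos_iff.2 (hz i)
    positivity
  -- The thresholds `c i = |z i|²` are those of the base point itself, so the cutoff is `1` nearby.
  refine ⟨_, isSmoothFun_cutoff_mul hs hc hF (x₀ := x₀), ?_⟩
  have h1 : ∀ᶠ q : HSpace d in 𝓝 p.1, ∀ i, ‖p.1.1 i‖ ^ 2 / 2 < ‖q.1 i‖ ^ 2 :=
    Filter.eventually_all.2 fun i => (continuous_norm_fst_sq i).continuousAt.eventually
      (lt_mem_nhds (half_lt_self (hc i)))
  have h2 : ∀ᶠ y : Y A α β in 𝓝 (proj p), quotientCutoff (fun i => ‖p.1.1 i‖ ^ 2) y = 1 := by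
    rw [← isOpenQuotientMap_proj.map_nhds_eq, Filter.eventually_map]
    filter_upwards [continuousAt_subtype_val.eventually h1] with q hq
    exact cutoff_eq_one hc hq
  have h3 : Filter.Tendsto (Subtype.val : Fiber A α β b → Y A α β) (𝓝 ⟨proj p, hp⟩)
    (𝓝 (proj p)) := continuousAt_subtype_val
  filter_upwards [h3.eventually h2] with x hx
  rw [hx, one_mul]
  rfl

/-- `flatPoint` is a smooth lift of the inverse coordinates to `ℍ^d`, so a local smooth extension to
`ℍ^d` can simply be composed with it. -/
theorem contMDiff_comp_fiberHomeo_symm {f : Fiber A α β b → ℝ} (hf : IsSmoothFunOnFiber f) :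
    ContMDiff (fiberModel n) 𝓘(ℝ, ℝ) ∞ (f ∘ (fiberHomeo hs hb hβ hx₀).symm) := by
  intro q
  obtain ⟨g, hg, hfg⟩ := hf ((fiberHomeo hs hb hβ hx₀).symm q)
  obtain ⟨U, G, hU, hqU, hG, hgG⟩ := hg ⟨flatPoint B C x₀ b q, flatPoint_mem hs hb hβ hx₀ q⟩
  have hsm := contMDiff_flatPoint (B := B) (C := C) (x₀ := x₀) hb
  have h1 : ContMDiffAt (fiberModel n) 𝓘(ℝ, ℝ) ∞ (G ∘ flatPoint B C x₀ b) q :=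
    ((hG.contDiffAt (hU.mem_nhds hqU)).contMDiffAt).comp q (hsm q)
  refine h1.congr_of_eventuallyEq ?_
  filter_upwards [(fiberHomeo hs hb hβ hx₀).symm.continuous.continuousAt.eventually hfg,
    hsm.continuous.continuousAt.eventually (hU.mem_nhds hqU)] with r hr hr'
  exact hr.trans (hgG ⟨flatPoint B C x₀ b r, flatPoint_mem hs hb hβ hx₀ r⟩ hr')

end SmoothFunctions

/-! ### Polar coordinates, base point and model space -/

section Polar

/-- Polar coordinates identify `T^n × ℝ^n` with `(ℂ^*)^n`. -/
def polarDiffeo (n : ℕ) :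
    FiberModel n ≃ₘ^∞⟮fiberModel n, complexTorusModel n⟯ (Fin n → ℂˣ) where
  toFun q j := Units.mk0 ((Real.exp (q.2 j) : ℂ) * q.1 j)
    (mul_ne_zero (Complex.ofReal_ne_zero.2 (Real.exp_pos _).ne') (Circle.coe_ne_zero _))
  invFun u := (fun j => phase (u j), WithLp.toLp 2 fun j => Real.log ‖(u j : ℂ)‖)
  left_inv q := by
    refine Prod.ext (funext fun j => phase_mul_real (Real.exp_pos _) _) ?_
    ext j
    simp only [Units.val_mk0, norm_mul, Circle.norm_coe, mul_one, Complex.norm_real,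
      Real.norm_of_nonneg (Real.exp_pos _).le, Real.log_exp]
  right_inv u := by
    funext j
    ext
    simp only [Units.val_mk0]
    rw [Real.exp_log (norm_pos_iff.2 (u j).ne_zero), norm_mul_phase]
  contMDiff_toFun := by
    rw [contMDiff_pi_iff]
    intro j
    -- `ℂˣ` carries the structure of an open subset of `ℂ`, so smoothness is tested after inclusion.
    refine ContMDiff.of_comp_isOpenEmbedding Units.isOpenEmbedding_val ?_
    have h1 : ContMDiff (fiberModel n) 𝓘(ℝ, ℂ) ∞ fun q : FiberModel n => (q.1 j : ℂ) :=
      contMDiff_circle_coe.comp ((contMDiff_eval (I := fun _ : Fin n => 𝓡 1) j).comp contMDiff_fst)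
    have h2 : ContMDiff (fiberModel n) 𝓘(ℝ, ℂ) ∞
        fun q : FiberModel n => (Real.exp (q.2 j) : ℂ) := by
      have : ContDiff ℝ ∞ fun s : EuclideanSpace ℝ (Fin n) => (Real.exp (s j) : ℂ) :=
        Complex.ofRealCLM.contDiff.comp
          (Real.contDiff_exp.comp (EuclideanSpace.proj (𝕜 := ℝ) j).contDiff)
      exact this.contMDiff.comp contMDiff_snd
    have hm : ContMDiff (𝓘(ℝ, ℂ × ℂ)) 𝓘(ℝ, ℂ) ∞ fun p : ℂ × ℂ => p.1 * p.2 :=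
      contDiff_mul.contMDiff
    exact hm.comp (h2.prodMk_space h1)
  contMDiff_invFun := by
    have hv (j : Fin n) : ContMDiff (complexTorusModel n) 𝓘(ℝ, ℂ) ∞
        fun u : Fin n → ℂˣ => (u j : ℂ) :=
      Units.contMDiff_val.comp (contMDiff_eval (I := fun _ : Fin n => 𝓘(ℝ, ℂ)) j)
    refine ContMDiff.prodMk ?_ ?_
    · rw [contMDiff_pi_iff]
      intro j u
      exact ContMDiffAt.comp (g := phase) u (contMDiffAt_phase (u j).ne_zero) (hv j u)
    · have h : ContMDiff (complexTorusModel n) 𝓘(ℝ, Fin n → ℝ) ∞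
          fun (u : Fin n → ℂˣ) j => Real.log ‖(u j : ℂ)‖ := by
        refine contMDiff_pi_space.2 fun j u => ?_
        have : ContDiffAt ℝ ∞ (fun z : ℂ => Real.log ‖z‖) (u j) :=
          (contDiffAt_norm ℝ (u j).ne_zero).log (norm_ne_zero_iff.2 (u j).ne_zero)
        exact ContMDiffAt.comp (g := fun z : ℂ => Real.log ‖z‖) u this.contMDiffAt (hv j u)
      exact (EuclideanSpace.equiv (Fin n) ℝ).symm.contDiff.contMDiff.comp h

end Polar

/-- Independent rows mean full row rank, so `A` is surjective over `ℝ`. -/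
theorem exists_mem_realSolutions (hA : LinearIndependent ℝ (realMat A).row) (α : Fin m → ℝ) :
    ∃ x₀, x₀ ∈ realSolutions A α := by
  have hr : Module.finrank ℝ (LinearMap.range (realMat A).mulVecLin) =
      Module.finrank ℝ (Fin m → ℝ) := by
    simpa [Matrix.rank] using hA.rank_matrix
  exact LinearMap.range_eq_top.1 (Submodule.eq_top_of_finrank_eq hr) α

/-- A linear identification of the model vector space of `T^n × ℝ^n` with `ℝ^{2n}`. -/
def modelEquiv (n : ℕ) : ((Fin n → EuclideanSpace ℝ (Fin 1)) × EuclideanSpace ℝ (Fin n)) ≃L[ℝ]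
    EuclideanSpace ℝ (Fin (2 * n)) :=
  ContinuousLinearEquiv.ofFinrankEq (by simp [Module.finrank_pi_fintype, two_mul])

end ToricHK

end

/-! ### The derivative of the real moment map -/

namespace ToricHK

variable {m n d : ℕ} {A : Matrix (Fin m) (Fin d) ℤ} {B : Matrix (Fin n) (Fin d) ℤ}
  {C : Matrix (Fin d) (Fin n) ℤ} {x₀ : Fin d → ℝ}

/-- The derivative is the linear map of `Bᵀ` after the second projection after the derivative of a
diffeomorphism. The last two are surjective, so the range is that of `Bᵀ`, which is the real kernel
of `A`. -/
theorem range_mfderiv_affinePoint (hs : IsSplitting A B C) {E : Type*} [NormedAddCommGroup E]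
    [NormedSpace ℝ E] {H : Type*} [TopologicalSpace H] {I : ModelWithCorners ℝ E H} {X : Type*}
    [TopologicalSpace X] [ChartedSpace H X] (Φ : X ≃ₘ^∞⟮I, fiberModel n⟯ FiberModel n) (x : X) :
    Set.range (mfderiv I 𝓘(ℝ, Fin d → ℝ) (fun y => affinePoint B x₀ (Φ y).2) x) =
      {v : Fin d → ℝ | realMat A *ᵥ v = 0} := by
  let T : EuclideanSpace ℝ (Fin n) →L[ℝ] Fin d → ℝ :=
    (LinearMap.toContinuousLinearMap (realMat B)ᵀ.mulVecLin).comp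
      (EuclideanSpace.equiv (Fin n) ℝ : EuclideanSpace ℝ (Fin n) →L[ℝ] Fin n → ℝ)
  have hT (s : EuclideanSpace ℝ (Fin n)) : T s = (realMat B)ᵀ *ᵥ s.ofLp := rfl
  have h1 : HasMFDerivAt (𝓡 n) 𝓘(ℝ, Fin d → ℝ) (affinePoint B x₀) (Φ x).2 T :=
    (T.hasFDerivAt.const_add x₀).hasMFDerivAt
  have hΦ : MDifferentiableAt I (fiberModel n) Φ x := Φ.mdifferentiable (by simp) x
  have h2 := h1.comp x ((hasMFDerivAt_snd (Φ x)).comp x hΦ.hasMFDerivAt)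
  have hsurj : Function.Surjective (mfderiv I (fiberModel n) Φ x) :=
    (Φ.mfderivToContinuousLinearEquiv (by simp) x).surjective
  have h3 := h2.mfderiv
  change mfderiv I 𝓘(ℝ, Fin d → ℝ) (fun y => affinePoint B x₀ (Φ y).2) x = _ at h3
  rw [h3]
  ext v
  constructor
  · rintro ⟨w, rfl⟩
    change realMat A *ᵥ ((realMat B)ᵀ *ᵥ _) = 0
    rw [Matrix.mulVec_mulVec, hs.real_mul_transpose, Matrix.zero_mulVec]
  · intro hv
    obtain ⟨s, rfl⟩ := hs.ker_left v hv
    obtain ⟨w, hw⟩ := hsurj ((0, WithLp.toLp 2 s) :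
      (Fin n → EuclideanSpace ℝ (Fin 1)) × EuclideanSpace ℝ (Fin n))
    refine ⟨w, ?_⟩
    change T (mfderiv I (fiberModel n) Φ x w).2 = _
    rw [hw]
    rfl

end ToricHK

/-! ### Assembly of the theorem -/

theorem theorem4p3 {m n d : ℕ} (hd : m + n = d) (A : Matrix (Fin m) (Fin d) ℤ)
    (hA : LinearIndependent ℝ (A.map (Int.cast : ℤ → ℝ)).row)
    (α : Fin m → ℝ) (β : Fin m → ℂ) (b : Fin d → ℂ)
    (hb : b ∈ ToricHK.complexSolutions A β \ ⋃ i, ToricHK.wall A β i) :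
    -- `F_b` is a smooth manifold of real dimension `2n`, for the smooth structure induced by `Y`
    T2Space (ToricHK.Fiber A α β b) ∧ SecondCountableTopology (ToricHK.Fiber A α β b) ∧
    ∃ _ : ChartedSpace (EuclideanSpace ℝ (Fin (2 * n))) (ToricHK.Fiber A α β b),
      IsManifold (𝓡 (2 * n)) ∞ (ToricHK.Fiber A α β b) ∧
      (∀ f : ToricHK.Fiber A α β b → ℝ,
        ContMDiff (𝓡 (2 * n)) 𝓘(ℝ, ℝ) ∞ f ↔ ToricHK.IsSmoothFunOnFiber f) ∧
      -- the quotient torus `N` acts smoothly and freely on `F_b`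
      ContMDiff ((ToricHK.torusModel d).prod (𝓡 (2 * n))) (𝓡 (2 * n)) ∞
        (fun x : ToricHK.Torus d × ToricHK.Fiber A α β b =>
          (x.1 : ToricHK.Torus d ⧸ ToricHK.subtorus A) • x.2) ∧
      (∀ (g : ToricHK.Torus d ⧸ ToricHK.subtorus A) (y : ToricHK.Fiber A α β b),
        g • y = y → g = 1) ∧
      -- the residual real moment map is a surjective submersion of `F_b` onto the real solution
      -- space, an affine space of dimension `n`
      ContMDiff (𝓡 (2 * n)) 𝓘(ℝ, Fin d → ℝ) ∞
        (fun y : ToricHK.Fiber A α β b => ToricHK.realMoment y.1) ∧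
      Set.range (fun y : ToricHK.Fiber A α β b => ToricHK.realMoment y.1) =
        ToricHK.realSolutions A α ∧
      (∀ y : ToricHK.Fiber A α β b,
        Set.range (mfderiv (𝓡 (2 * n)) 𝓘(ℝ, Fin d → ℝ)
          (fun y : ToricHK.Fiber A α β b => ToricHK.realMoment y.1) y) =
        {v : Fin d → ℝ | A.map (Int.cast : ℤ → ℝ) *ᵥ v = 0}) ∧
      Module.finrank ℝ (LinearMap.ker (A.map (Int.cast : ℤ → ℝ)).mulVecLin) = n ∧
      -- `F_b` is diffeomorphic to `(ℂ^*)^n` and to `T^n × ℝ^n`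
      Nonempty (ToricHK.Fiber A α β b ≃ₘ^∞⟮𝓡 (2 * n), ToricHK.complexTorusModel n⟯
        (Fin n → ℂˣ)) ∧
      Nonempty (ToricHK.Fiber A α β b ≃ₘ^∞⟮𝓡 (2 * n), (ToricHK.torusModel n).prod (𝓡 n)⟯
        (ToricHK.Torus n × EuclideanSpace ℝ (Fin n))) := by
  have hb' (i : Fin d) : b i ≠ 0 := fun h => hb.2 (Set.mem_iUnion.2 ⟨i, hb.1, h⟩)
  obtain ⟨B, C, hs⟩ := ToricHK.exists_isSplitting hd A hA
  obtain ⟨x₀, hx₀⟩ := ToricHK.exists_mem_realSolutions hA α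
  let Φ := ToricHK.fiberHomeo hs hb' hb.1 hx₀
  let := ToricHK.transportCharts (ToricHK.fiberModel n) (ToricHK.modelEquiv n) Φ
  have hΦ : ContMDiff (𝓡 (2 * n)) (ToricHK.fiberModel n) ∞ Φ :=
    ToricHK.contMDiff_transport (ToricHK.fiberModel n) (ToricHK.modelEquiv n) Φ ∞
  have hΦ' : ContMDiff (ToricHK.fiberModel n) (𝓡 (2 * n)) ∞ Φ.symm :=
    ToricHK.contMDiff_transport_symm (ToricHK.fiberModel n) (ToricHK.modelEquiv n) Φ ∞
  let Ψ : ToricHK.Fiber A α β b ≃ₘ^∞⟮𝓡 (2 * n), ToricHK.fiberModel n⟯ ToricHK.FiberModel n :=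
    ⟨Φ.toEquiv, hΦ, hΦ'⟩
  have hmom : (fun y : ToricHK.Fiber A α β b => ToricHK.realMoment y.1) =
      fun y => ToricHK.affinePoint B x₀ (Ψ y).2 :=
    funext (ToricHK.realMoment_eq hs hb' hb.1 hx₀)
  have : T2Space (ToricHK.Fiber A α β b) := Φ.isEmbedding.t2Space
  have : SecondCountableTopology (ToricHK.Fiber A α β b) := Φ.isEmbedding.secondCountableTopology
  refine ⟨inferInstance, inferInstance, inferInstance,
    ToricHK.isManifold_transport (ToricHK.fiberModel n) (ToricHK.modelEquiv n) Φ ∞,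
    fun f => ⟨fun hf => ?_, fun hf => ?_⟩, ?_, ToricHK.eq_one_of_smul_eq hs hb' hb.1 hx₀, ?_,
    ToricHK.range_realMoment hs hb' hb.1 hx₀, ?_,
    ToricHK.finrank_ker_of_linearIndependent hd hA, ⟨Ψ.trans (ToricHK.polarDiffeo n)⟩, ⟨Ψ⟩⟩
  · have := ToricHK.isSmoothFunOnFiber_comp hs hb' hb.1 hx₀ (hf.comp hΦ')
    simpa [Φ] using this
  · have := (ToricHK.contMDiff_comp_fiberHomeo_symm hs hb' hb.1 hx₀ hf).comp hΦ
    rw [Function.comp_assoc, Homeomorph.symm_comp_self] at this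
    exact this
  -- In coordinates the action, pulled back to `T^d`, is multiplication by `monomial B ζ` on the
  -- torus factor.
  · have h : ContMDiff ((ToricHK.torusModel d).prod (𝓡 (2 * n))) (ToricHK.fiberModel n) ∞
        (fun x : ToricHK.Torus d × ToricHK.Fiber A α β b =>
          ((ToricHK.monomial B x.1 * (Φ x.2).1, (Φ x.2).2) : ToricHK.FiberModel n)) := by
      have h1 := contMDiff_fst.comp (hΦ.comp
        (contMDiff_snd (I := ToricHK.torusModel d) (M := ToricHK.Torus d)))
      have h2 := (ToricHK.contMDiff_monomial B).comp
        (contMDiff_fst (J := 𝓡 (2 * n)) (N := ToricHK.Fiber A α β b))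
      refine ContMDiff.prodMk (ToricHK.contMDiff_pi_iff.2 fun j => ?_)
        (contMDiff_snd.comp (hΦ.comp contMDiff_snd))
      exact (ToricHK.contMDiff_pi_iff.1 h2 j).mul (ToricHK.contMDiff_pi_iff.1 h1 j)
    refine (hΦ'.comp h).congr fun x => ?_
    refine (Φ.symm_apply_apply _).symm.trans (congrArg Φ.symm ?_)
    exact ToricHK.fiberHomeo_smul hs hb' hb.1 hx₀ x.1 x.2
  · rw [hmom]
    exact (ToricHK.contDiff_affinePoint B x₀).contMDiff.comp (contMDiff_snd.comp hΦ)
  · intro y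
    rw [hmom]
    exact ToricHK.range_mfderiv_affinePoint hs Ψ y
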